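/- Let $k$ be a field, $R=k[x_0,x_1,x_2,y]$, $\mathfrak m=(x_0,x_1,x_2,y)$. Let $m_0<m_1<m_2<m_3$ be positive integers with $\gcd(m_0,m_1,m_2,m_3)=1$ that form an arithmetic progression with common difference $d\ge 1$, and write $m_0=3a+b$ with integers $a\ge 1$ and $b\in\{1,2,3\}$. Let $C$ be the monomial curve $x_0=t^{m_0},\ x_1=t^{m_1},\ x_2=t^{m_2},\ y=t^{m_3}$ in $\mathbb A^4$, and let $I(C)\subset R$ be the kernel of the $k$-algebra homomorphism $R\to k[t]$ given by this substitution. For $f\in R$, let $f^*$ be the homogeneous summand of $f$ of least degree ($0^*=0$), let $I(C)^*$ be the ideal generated by all $f^*$ with $f\in I(C)$, and let $G=R/I(C)^*$ be the coordinate ring of the tangent cone of $C$ at the origin. Then the sequence of $R$-modules $$0\longrightarrow R^{\beta_3(b)}\xrightarrow{\phi_3(b)}R^{\beta_2(b)}\xrightarrow{\phi_2(b)}R^{\beta_1(b)}\xrightarrow{\phi_1(b)}R\xrightarrow{\ \phi\ }G\longrightarrow 0,$$ where $\phi$ is the canonical surjection, $(\beta_1,\beta_2,\beta_3)(b)=(6,8,3),\,(5,5,1),\,(4,5,2)$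 for $b=1,2,3$ respectively, and the other maps are multiplication of column vectors by the matrices below, is a minimal graded free resolution of $G$. That is, the sequence is exact, each $\phi_i(b)$ $(i=1,2,3)$ has image contained in $\mathfrak m$ times its target, and the standard basis vectors of the free modules can be given degrees (with $1\in R$ in degree $0$) for which all $\phi_i(b)$ are homogeneous of degree $0$. Put $g_1=x_1^2-x_0x_2$, $g_2=x_1x_2-x_0y$, $g_3=x_2^2-x_1y$. For $b=1$: $\phi_1=(g_1\ \ g_2\ \ g_3\ \ x_1y^a\ \ x_2y^a\ \ y^{a+1})$, $$\phi_2=\begin{pmatrix} x_2&y^a&-y&0&0&0&0&0\\ -x_1&0&x_2&y^a&0&0&0&0\\ x_0&0&-x_1&0&y^a&0&0&0\\ 0&-x_1&0&-x_2&0&x_2&y&0\\ 0&x_0&0&0&-x_2&-x_1&0&y\\ 0&0&0&x_0&x_1&0&-x_1&-x_2 \end{pmatrix},\qquad \phi_3=\begin{pmatrix} y^a&0&0\\ -x_2&y&0\\ 0&y^a&0\\ x_1&-x_2&0\\ -x_0&x_1&0\\ 0&-x_2&y\\ 0&x_1&-x_2\\ 0&-x_0&x_1 \end{pmatrix}.$$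 For $b=2$: $\phi_1=(g_1\ \ g_2\ \ g_3\ \ x_2y^a\ \ y^{a+1})$, $$\phi_2=\begin{pmatrix} x_2&-y&0&0&0\\ -x_1&x_2&y^a&0&0\\ x_0&-x_1&0&y^a&0\\ 0&0&-x_1&-x_2&y\\ 0&0&x_0&x_1&-x_2 \end{pmatrix},\qquad \phi_3=\begin{pmatrix}y^{a+1}\\ x_2y^a\\ -g_3\\ g_2\\ g_1\end{pmatrix}.$$ For $b=3$: $\phi_1=(g_1\ \ g_2\ \ g_3\ \ y^{a+1})$, $$\phi_2=\begin{pmatrix} x_2&y^{a+1}&-y&0&0\\ -x_1&0&x_2&y^{a+1}&0\\ x_0&0&-x_1&0&y^{a+1}\\ 0&-g_1&0&-g_2&-g_3 \end{pmatrix},\qquad \phi_3=\begin{pmatrix}y^{a+1}&0\\ -x_2&y\\ 0&y^{a+1}\\ x_1&-x_2\\ -x_0&x_1\end{pmatrix}.$$ -/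

import Mathlib

open MvPolynomial

namespace MonomialCurve

section Curve

variable {k : Type*} [Field k]

/-- The coordinate homomorphism `k[x₀, x₁, x₂, y] → k[t]`, `xᵢ ↦ t ^ mᵢ` (with `y` the variable of
index `3`).  Its image is `k[t ^ m₀, …, t ^ m₃]`. -/
noncomputable def param (k : Type*) [Field k] (m : Fin 4 → ℕ) :
    MvPolynomial (Fin 4) k →ₐ[k] Polynomial k :=
  aeval fun i => (Polynomial.X : Polynomial k) ^ m i

/-- The defining ideal `I(C)` of the monomial curve with exponents `m`. -/
noncomputable def curveIdeal (k : Type*) [Field k] (m : Fin 4 → ℕ) :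
    Ideal (MvPolynomial (Fin 4) k) :=
  RingHom.ker (param k m)

/-- `f^*`: the homogeneous summand of `f` of least degree (and `0` for `f = 0`). -/
noncomputable def leastForm (f : MvPolynomial (Fin 4) k) : MvPolynomial (Fin 4) k :=
  homogeneousComponent (sInf {n : ℕ | homogeneousComponent n f ≠ 0}) f

/-- `I^*`: the ideal generated by the forms `f^*`, `f ∈ I`. -/
noncomputable def leastFormIdeal (I : Ideal (MvPolynomial (Fin 4) k)) :
    Ideal (MvPolynomial (Fin 4) k) :=
  Ideal.span {g | ∃ f ∈ I, g = leastForm f}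

/-- `I(C)^*`, the defining ideal of the tangent cone at the origin of the monomial curve with
exponents `m`. -/
noncomputable def tangentConeIdeal (k : Type*) [Field k] (m : Fin 4 → ℕ) :
    Ideal (MvPolynomial (Fin 4) k) :=
  leastFormIdeal (curveIdeal k m)

/-- The irrelevant maximal ideal `(x₀, x₁, x₂, y)`. -/
noncomputable def irrelevantIdeal (k : Type*) [Field k] : Ideal (MvPolynomial (Fin 4) k) :=
  Ideal.span (Set.range X)

/-- With `R = k[x₀, x₁, x₂, y]`, the sequence
`0 → R ^ n₃ --A₃--> R ^ n₂ --A₂--> R ^ n₁ --A₁--> R → R ⧸ I → 0`,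
whose last map is the canonical surjection and whose other maps are multiplication of column
vectors by the given matrices (`A₁` being a row), is a minimal (graded) free resolution of `R ⧸ I`:
it is exact, each map `Aᵢ` has image in `𝔪` times its target, and the maps are homogeneous
of degree `0` for suitable degrees `d₁, d₂, d₃` of the standard basis vectors
(the basis vector `1` of `R` having degree `0`). -/
structure IsMinimalFreeResolution (I : Ideal (MvPolynomial (Fin 4) k)) {n₁ n₂ n₃ : ℕ}
    (A₁ : Fin n₁ → MvPolynomial (Fin 4) k)
    (A₂ : Matrix (Fin n₁) (Fin n₂) (MvPolynomial (Fin 4) k))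
    (A₃ : Matrix (Fin n₂) (Fin n₃) (MvPolynomial (Fin 4) k)) : Prop where
  surjective : Function.Surjective (Ideal.Quotient.mk I)
  exact_zero : Function.Exact (Fintype.linearCombination (MvPolynomial (Fin 4) k) A₁)
    (Ideal.Quotient.mk I)
  exact_one : Function.Exact A₂.mulVecLin (Fintype.linearCombination (MvPolynomial (Fin 4) k) A₁)
  exact_two : Function.Exact A₃.mulVecLin A₂.mulVecLin
  injective : Function.Injective A₃.mulVecLin
  minimal_one : LinearMap.range (Fintype.linearCombination (MvPolynomial (Fin 4) k) A₁) ≤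
    irrelevantIdeal k • (⊤ : Submodule (MvPolynomial (Fin 4) k) (MvPolynomial (Fin 4) k))
  minimal_two : LinearMap.range A₂.mulVecLin ≤
    irrelevantIdeal k • (⊤ : Submodule (MvPolynomial (Fin 4) k) (Fin n₁ → MvPolynomial (Fin 4) k))
  minimal_three : LinearMap.range A₃.mulVecLin ≤
    irrelevantIdeal k • (⊤ : Submodule (MvPolynomial (Fin 4) k) (Fin n₂ → MvPolynomial (Fin 4) k))
  graded : ∃ (d₁ : Fin n₁ → ℕ) (d₂ : Fin n₂ → ℕ) (d₃ : Fin n₃ → ℕ),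
    (∀ j, (A₁ j).IsHomogeneous (d₁ j)) ∧
    (∀ i j, A₂ i j ≠ 0 → ∃ e, (A₂ i j).IsHomogeneous e ∧ d₁ i + e = d₂ j) ∧
    (∀ i j, A₃ i j ≠ 0 → ∃ e, (A₃ i j).IsHomogeneous e ∧ d₂ i + e = d₃ j)

end Curve

section Matrices

variable {R : Type*} [CommRing R]

/-! The differentials `φᵢ(b)`, written `phiᵢ_b`. -/

def phi1_1 (a : ℕ) (x₀ x₁ x₂ y : R) : Fin 6 → R :=
  ![x₁ ^ 2 - x₀ * x₂, x₁ * x₂ - x₀ * y, x₂ ^ 2 - x₁ * y, x₁ * y ^ a, x₂ * y ^ a, y ^ (a + 1)]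

def phi2_1 (a : ℕ) (x₀ x₁ x₂ y : R) : Matrix (Fin 6) (Fin 8) R :=
  !![x₂,  y ^ a, -y,  0,     0,     0,   0,   0;
     -x₁, 0,     x₂,  y ^ a, 0,     0,   0,   0;
     x₀,  0,     -x₁, 0,     y ^ a, 0,   0,   0;
     0,   -x₁,   0,   -x₂,   0,     x₂,  y,   0;
     0,   x₀,    0,   0,     -x₂,   -x₁, 0,   y;
     0,   0,     0,   x₀,    x₁,    0,   -x₁, -x₂]

def phi3_1 (a : ℕ) (x₀ x₁ x₂ y : R) : Matrix (Fin 8) (Fin 3) R :=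
  !![y ^ a, 0,     0;
     -x₂,   y,     0;
     0,     y ^ a, 0;
     x₁,    -x₂,   0;
     -x₀,   x₁,    0;
     0,     -x₂,   y;
     0,     x₁,    -x₂;
     0,     -x₀,   x₁]

def phi1_2 (a : ℕ) (x₀ x₁ x₂ y : R) : Fin 5 → R :=
  ![x₁ ^ 2 - x₀ * x₂, x₁ * x₂ - x₀ * y, x₂ ^ 2 - x₁ * y, x₂ * y ^ a, y ^ (a + 1)]

def phi2_2 (a : ℕ) (x₀ x₁ x₂ y : R) : Matrix (Fin 5) (Fin 5) R :=
  !![x₂,  -y,  0,     0,     0;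
     -x₁, x₂,  y ^ a, 0,     0;
     x₀,  -x₁, 0,     y ^ a, 0;
     0,   0,   -x₁,   -x₂,   y;
     0,   0,   x₀,    x₁,    -x₂]

def phi3_2 (a : ℕ) (x₀ x₁ x₂ y : R) : Matrix (Fin 5) (Fin 1) R :=
  !![y ^ (a + 1);
     x₂ * y ^ a;
     -x₂ ^ 2 + x₁ * y;
     x₁ * x₂ - x₀ * y;
     x₁ ^ 2 - x₀ * x₂]

def phi1_3 (a : ℕ) (x₀ x₁ x₂ y : R) : Fin 4 → R :=
  ![x₁ ^ 2 - x₀ * x₂, x₁ * x₂ - x₀ * y, x₂ ^ 2 - x₁ * y, y ^ (a + 1)]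

def phi2_3 (a : ℕ) (x₀ x₁ x₂ y : R) : Matrix (Fin 4) (Fin 5) R :=
  !![x₂,  y ^ (a + 1),        -y,  0,                 0;
     -x₁, 0,                  x₂,  y ^ (a + 1),       0;
     x₀,  0,                  -x₁, 0,                 y ^ (a + 1);
     0,   -x₁ ^ 2 + x₀ * x₂,  0,   -(x₁ * x₂) + x₀ * y, -x₂ ^ 2 + x₁ * y]

def phi3_3 (a : ℕ) (x₀ x₁ x₂ y : R) : Matrix (Fin 5) (Fin 2) R :=
  !![y ^ (a + 1), 0;
     -x₂,         y;
     0,           y ^ (a + 1);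
     x₁,          -x₂;
     -x₀,         x₁]

end Matrices

end MonomialCurve

/-! Two independent facts are combined: the first row generates the tangent cone ideal, and the
matrices resolve the ideal of that row.

Generators. The minors `g₁, g₂, g₃` vanish on the curve, and each `xᵢ y^a` with `i = b + j`
(including `y^(a+1)`) is the least form of `xᵢ y^a - xⱼ x₀^(a+d)`, so all lie in the tangent cone
ideal. Conversely, a monomial of degree `n` and index sum `s` has `t`-weight `n m₀ + s d`, and
modulo the minors it depends only on `(n, s)` (`monomial_eq_normalMonomial`). If `n` is the least
degree of `f ∈ I(C)` and `s < m₀`, coprimality of `m₀` and `d` lets no other pair of degree at least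
`n` have the same weight; hence the coefficients of `f^*` with index sum `s` add up to zero
(`sum_coeff_leastForm_eq_zero`). The classes with `s ≥ m₀ = 3a + b` are killed by the remaining
generators (`normalMonomial_eq_zero`).

Exactness. The syzygies of the minors are the two Hilbert-Burch columns (`syzygies_minors`), and `y`
is a nonzerodivisor modulo the minors (`exists_minors_of_mul`). So a relation among all generators
yields a combination of minors lying in `(x₁, x₂, y)`, `(x₂, y)` or `(y)` according to `b`, and what
remains is a Koszul relation among those variables. Minimality and grading are read off the entries.
-/

open MvPolynomial

namespace MonomialCurve

/-! ### Syzygies of the `2 × 2` minors and Koszul relations. -/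

section Syzygies

variable {R : Type*} [CommRing R]

/-- The divisibility properties of the variables of a polynomial ring on which the exactness of the
resolutions rests. -/
structure IsIndependentQuadruple (x₀ x₁ x₂ y : R) : Prop where
  prime : Prime y
  not_dvd : ¬ y ∣ x₂
  exists_of_mul : ∀ w p q, x₁ * w = x₂ * p + y * q → ∃ p' q', w = x₂ * p' + y * q'
  minor_ne_zero : x₁ * x₂ - x₀ * y ≠ 0
  dvd_of_mul : ∀ w, x₁ * x₂ - x₀ * y ∣ (x₂ ^ 2 - x₁ * y) * w → x₁ * x₂ - x₀ * y ∣ w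

namespace IsIndependentQuadruple

variable {x₀ x₁ x₂ y : R}

lemma dvd_of_dvd_mul (h : IsIndependentQuadruple x₀ x₁ x₂ y)
    {w : R} (hw : y ∣ x₂ * w) : y ∣ w :=
  (h.prime.dvd_or_dvd hw).resolve_left h.not_dvd

/-- Modulo `(x₂, y)` only the first minor survives, as `x₁ ^ 2`, and `x₁` is a nonzerodivisor there,
so it can be divided out twice. The sign of `v` matches the Hilbert-Burch columns. -/
lemma exists_first_coeff (h : IsIndependentQuadruple x₀ x₁ x₂ y)
    {w₁ w₂ w₃ p q : R}
    (hw : w₁ * (x₁ ^ 2 - x₀ * x₂) + w₂ * (x₁ * x₂ - x₀ * y) + w₃ * (x₂ ^ 2 - x₁ * y) =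
      x₂ * p + y * q) : ∃ u v, w₁ = u * x₂ - v * y := by
  obtain ⟨p', q', h1⟩ := h.exists_of_mul (x₁ * w₁)
    (p + w₁ * x₀ - w₂ * x₁ - w₃ * x₂) (q + w₂ * x₀ + w₃ * x₁) (by linear_combination hw)
  obtain ⟨u, v, h2⟩ := h.exists_of_mul w₁ p' q' h1
  exact ⟨u, -v, by linear_combination h2⟩

variable [IsDomain R]

lemma pow_dvd_of_dvd_mul (h : IsIndependentQuadruple x₀ x₁ x₂ y)
    {n : ℕ} {w : R} (hw : y ^ n ∣ x₂ * w) : y ^ n ∣ w :=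
  h.prime.pow_dvd_of_dvd_mul_left n h.not_dvd hw

lemma pow_dvd_of_dvd_minor_mul (h : IsIndependentQuadruple x₀ x₁ x₂ y)
    {n : ℕ} {w : R} (hw : y ^ n ∣ (x₂ ^ 2 - x₁ * y) * w) :
    y ^ n ∣ w := by
  refine h.prime.pow_dvd_of_dvd_mul_left n (fun hd => h.not_dvd ?_) hw
  refine h.prime.dvd_of_dvd_pow (n := 2) ?_
  have := dvd_add hd (Dvd.intro_left x₁ rfl)
  rwa [sub_add_cancel] at this

lemma koszul_two (h : IsIndependentQuadruple x₀ x₁ x₂ y)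
    {s t : R} (hs : s * x₂ + t * y = 0) : ∃ c, s = c * y ∧ t = -c * x₂ := by
  obtain ⟨c, hc⟩ := h.dvd_of_dvd_mul (w := s) ⟨-t, by linear_combination hs⟩
  refine ⟨c, by rw [hc, mul_comm], mul_right_cancel₀ h.prime.ne_zero ?_⟩
  rw [hc] at hs
  linear_combination hs

lemma koszul_three (h : IsIndependentQuadruple x₀ x₁ x₂ y)
    {r s t : R} (hs : r * x₁ + s * x₂ + t * y = 0) :
    ∃ p q c, r = x₂ * p + y * q ∧ s = -x₁ * p + y * c ∧ t = -x₁ * q - x₂ * c := by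
  obtain ⟨p, q, hr⟩ := h.exists_of_mul r (-s) (-t) (by linear_combination hs)
  obtain ⟨c, h1, h2⟩ := h.koszul_two (s := s + x₁ * p) (t := t + x₁ * q)
    (by rw [hr] at hs; linear_combination hs)
  exact ⟨p, q, c, hr, by linear_combination h1, by linear_combination h2⟩

/-- The Hilbert-Burch syzygies of the `2 × 2` minors. -/
lemma syzygies_minors (h : IsIndependentQuadruple x₀ x₁ x₂ y)
    {w₁ w₂ w₃ : R}
    (hw : w₁ * (x₁ ^ 2 - x₀ * x₂) + w₂ * (x₁ * x₂ - x₀ * y) + w₃ * (x₂ ^ 2 - x₁ * y) = 0) :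
    ∃ u v, w₁ = u * x₂ - v * y ∧ w₂ = -u * x₁ + v * x₂ ∧ w₃ = u * x₀ - v * x₁ := by
  obtain ⟨u, v, rfl⟩ := h.exists_first_coeff (w₁ := w₁) (w₂ := w₂) (w₃ := w₃)
    (p := 0) (q := 0) (by linear_combination hw)
  -- Subtracting `u` and `v` times the two columns kills the first coefficient and leaves a relation
  -- between the last two minors, which is a multiple `c` of their Koszul relation.
  have hz : (w₂ + u * x₁ - v * x₂) * (x₁ * x₂ - x₀ * y) +
      (x₂ ^ 2 - x₁ * y) * (w₃ - u * x₀ + v * x₁) = 0 := by linear_combination hw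
  obtain ⟨c, hc⟩ := h.dvd_of_mul (w₃ - u * x₀ + v * x₁)
    ⟨-(w₂ + u * x₁ - v * x₂), by linear_combination hz⟩
  have h2 : w₂ + u * x₁ - v * x₂ = -c * (x₂ ^ 2 - x₁ * y) := by
    refine mul_right_cancel₀ h.minor_ne_zero ?_
    rw [hc] at hz
    linear_combination hz
  -- The Koszul relation is itself the combination of the two columns with coefficients `-y` and
  -- `-x₂`.
  exact ⟨u - c * y, v - c * x₂, by ring, by linear_combination h2, by linear_combination hc⟩

/-- `y` is a nonzerodivisor modulo the `2 × 2` minors. -/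
lemma exists_minors_of_mul (h : IsIndependentQuadruple x₀ x₁ x₂ y)
    {f w₁ w₂ w₃ : R}
    (hw : y * f = w₁ * (x₁ ^ 2 - x₀ * x₂) + w₂ * (x₁ * x₂ - x₀ * y) + w₃ * (x₂ ^ 2 - x₁ * y)) :
    ∃ z₁ z₂ z₃,
      f = z₁ * (x₁ ^ 2 - x₀ * x₂) + z₂ * (x₁ * x₂ - x₀ * y) + z₃ * (x₂ ^ 2 - x₁ * y) := by
  -- The next three steps show that, modulo `y`, the coefficient vector is a combination `u`, `v` of
  -- the two Hilbert-Burch columns.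
  obtain ⟨u, z₁, rfl⟩ := h.exists_first_coeff (w₁ := w₁) (w₂ := w₂) (w₃ := w₃)
    (p := 0) (q := f) (by linear_combination -hw)
  obtain ⟨e, he⟩ := h.dvd_of_dvd_mul (w := (w₂ + u * x₁) * x₁ + (w₃ - u * x₀) * x₂)
    ⟨f + z₁ * (x₁ ^ 2 - x₀ * x₂) + w₂ * x₀ + w₃ * x₁, by linear_combination -hw⟩
  obtain ⟨v, z₂, h2⟩ := h.exists_of_mul (w₂ + u * x₁) (-(w₃ - u * x₀)) e
    (by linear_combination he)
  obtain ⟨z₃, h3⟩ := h.dvd_of_dvd_mul (w := v * x₁ + (w₃ - u * x₀))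
    ⟨e - z₂ * x₁, by rw [h2] at he; linear_combination he⟩
  -- The vector `w` is `u` and `v` times the columns plus `y * (v - z₁, z₂, z₃)`; the columns pair
  -- to zero with the minors, and `y` cancels.
  refine ⟨v - z₁, z₂, z₃, mul_left_cancel₀ h.prime.ne_zero ?_⟩
  rw [hw, show w₂ = x₂ * v + y * z₂ - u * x₁ by linear_combination h2,
    show w₃ = y * z₃ - v * x₁ + u * x₀ by linear_combination h3]
  ring

lemma exists_minors_of_pow_mul (h : IsIndependentQuadruple x₀ x₁ x₂ y)
    (n : ℕ) {f w₁ w₂ w₃ : R}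
    (hw : y ^ n * f =
      w₁ * (x₁ ^ 2 - x₀ * x₂) + w₂ * (x₁ * x₂ - x₀ * y) + w₃ * (x₂ ^ 2 - x₁ * y)) :
    ∃ z₁ z₂ z₃,
      f = z₁ * (x₁ ^ 2 - x₀ * x₂) + z₂ * (x₁ * x₂ - x₀ * y) + z₃ * (x₂ ^ 2 - x₁ * y) := by
  induction n generalizing w₁ w₂ w₃ with
  | zero => exact ⟨w₁, w₂, w₃, by rw [← hw, pow_zero, one_mul]⟩
  | succ n ih =>
    obtain ⟨z₁, z₂, z₃, hz⟩ := h.exists_minors_of_mul (f := y ^ n * f) (by rw [← hw]; ring)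
    exact ih hz

/-- The syzygies of the minors modulo `y ^ n`. -/
lemma syzygies_minors_pow (h : IsIndependentQuadruple x₀ x₁ x₂ y)
    {n : ℕ} {r₁ r₂ r₃ f : R}
    (hr : r₁ * (x₁ ^ 2 - x₀ * x₂) + r₂ * (x₁ * x₂ - x₀ * y) + r₃ * (x₂ ^ 2 - x₁ * y) +
      f * y ^ n = 0) :
    ∃ u v w₁ w₂ w₃, r₁ = u * x₂ - v * y - w₁ * y ^ n ∧ r₂ = -u * x₁ + v * x₂ - w₂ * y ^ n ∧
      r₃ = u * x₀ - v * x₁ - w₃ * y ^ n ∧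
      f = w₁ * (x₁ ^ 2 - x₀ * x₂) + w₂ * (x₁ * x₂ - x₀ * y) + w₃ * (x₂ ^ 2 - x₁ * y) := by
  obtain ⟨w₁, w₂, w₃, hf⟩ := h.exists_minors_of_pow_mul n (f := f) (w₁ := -r₁) (w₂ := -r₂)
    (w₃ := -r₃) (by linear_combination hr)
  -- Substituting the expression of `f` by minors turns the relation into a genuine syzygy of the
  -- minors.
  obtain ⟨u, v, h1, h2, h3⟩ := h.syzygies_minors (w₁ := r₁ + w₁ * y ^ n) (w₂ := r₂ + w₂ * y ^ n)
    (w₃ := r₃ + w₃ * y ^ n) (by rw [hf] at hr; linear_combination hr)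
  exact ⟨u, v, w₁, w₂, w₃, by linear_combination h1, by linear_combination h2,
    by linear_combination h3, hf⟩

/-- The relations between the columns of the Hilbert-Burch matrix modulo `y ^ n`. -/
lemma hilbertBurch_pow (h : IsIndependentQuadruple x₀ x₁ x₂ y)
    {n : ℕ} {v₁ v₂ v₃ v₄ v₅ : R} (h1 : x₂ * v₁ + y ^ n * v₂ - y * v₃ = 0)
    (h2 : -x₁ * v₁ + x₂ * v₃ + y ^ n * v₄ = 0) (h3 : x₀ * v₁ - x₁ * v₃ + y ^ n * v₅ = 0) :
    ∃ c₁ c₂, v₁ = y ^ n * c₁ ∧ v₂ = -x₂ * c₁ + y * c₂ ∧ v₃ = y ^ n * c₂ ∧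
      v₄ = x₁ * c₁ - x₂ * c₂ ∧ v₅ = -x₀ * c₁ + x₁ * c₂ := by
  have hy : y ^ n ≠ 0 := pow_ne_zero n h.prime.ne_zero
  -- Eliminating `v₃` from the first two rows gives `y ^ n ∣ (x₂ ^ 2 - x₁ * y) * v₁`.
  obtain ⟨c₁, rfl⟩ := h.pow_dvd_of_dvd_minor_mul (n := n) (w := v₁)
    ⟨-(x₂ * v₂ + y * v₄), by linear_combination x₂ * h1 + y * h2⟩
  obtain ⟨c₂, rfl⟩ := h.pow_dvd_of_dvd_mul (n := n) (w := v₃)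
    ⟨x₁ * c₁ - v₄, by linear_combination h2⟩
  exact ⟨c₁, c₂, rfl, mul_left_cancel₀ hy (by linear_combination h1), rfl,
    mul_left_cancel₀ hy (by linear_combination h2), mul_left_cancel₀ hy (by linear_combination h3)⟩

end IsIndependentQuadruple

end Syzygies

/-! ### The variables of the polynomial ring; minimality criteria. -/

section PolynomialRing

variable {k : Type*} [Field k]

lemma isIndependentQuadruple_X :
    IsIndependentQuadruple (X 0 : MvPolynomial (Fin 4) k) (X 1) (X 2) (X 3) where
  prime := X_prime
  not_dvd := by
    rw [X_dvd_X]
    decide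
  exists_of_mul w p q hw := by
    -- The ideal `(x₂, y)` is monomial, so membership is tested on exponents, and multiplication by
    -- `x₁` leaves those of `x₂` and `y` unchanged.
    have key : w ∈ Ideal.span (X '' ({2, 3} : Set (Fin 4))) := by
      have h1 : X 1 * w ∈ Ideal.span ((X : Fin 4 → MvPolynomial (Fin 4) k) '' {2, 3}) := by
        rw [Set.image_pair, Ideal.mem_span_pair]
        exact ⟨p, q, by rw [hw]; ring⟩
      rw [mem_ideal_span_X_image] at h1 ⊢
      intro e he
      obtain ⟨i, hi, h2⟩ := h1 (e + Finsupp.single 1 1) (by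
        rw [mem_support_iff, mul_comm, coeff_mul_X]; exact mem_support_iff.mp he)
      refine ⟨i, hi, ?_⟩
      rcases hi with rfl | rfl <;> simpa [Finsupp.single_apply] using h2
    rw [Set.image_pair, Ideal.mem_span_pair] at key
    obtain ⟨p', q', h⟩ := key
    exact ⟨p', q', by rw [← h]; ring⟩
  minor_ne_zero h := by
    simpa using congrArg (eval ![0, 1, 1, 0]) h
  dvd_of_mul w hw := by
    -- The minor is linear in `x₀` with leading coefficient `-y`, which is relatively prime to `x₁
    -- x₂`.
    have hirr : Irreducible (-X 3 * X 0 + X 1 * X 2 : MvPolynomial (Fin 4) k) := by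
      refine irreducible_mul_X_add _ _ _ (by simp) ?_ ?_ ?_
      · rw [vars_neg, vars_X]
        decide
      · intro hmem
        have h0 := vars_mul (X 1 : MvPolynomial (Fin 4) k) (X 2) hmem
        rw [vars_X, vars_X] at h0
        revert h0
        decide
      · refine (X_prime.irreducible.isRelPrime_iff_not_dvd.mpr fun hd => ?_).neg_left
        rcases X_prime.dvd_or_dvd hd with hd | hd <;> rw [X_dvd_X] at hd <;> revert hd <;> decide
    have hp : Prime (X 1 * X 2 - X 0 * X 3 : MvPolynomial (Fin 4) k) := by
      convert hirr.prime using 1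
      ring
    -- At the point `(0, 0, 1, 0)` the second minor vanishes and the third does not.
    refine (hp.dvd_or_dvd hw).resolve_left fun ⟨c, hc⟩ => ?_
    simpa using congrArg (eval ![0, 0, 1, 0]) hc

lemma mem_irrelevantIdeal {p : MvPolynomial (Fin 4) k} :
    p ∈ irrelevantIdeal k ↔ constantCoeff p = 0 := by
  have := mem_pow_idealOfVars_iff' (σ := Fin 4) (R := k) 1 p
  rw [pow_one] at this
  refine this.trans ⟨fun h => h 0 (by simp), fun h e he => ?_⟩
  rw [Nat.lt_one_iff, Finsupp.degree_eq_zero_iff] at he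
  rw [he]
  exact h

lemma mulVec_mem_irrelevantIdeal_smul_top {n l : ℕ}
    {A : Matrix (Fin n) (Fin l) (MvPolynomial (Fin 4) k)}
    (hA : ∀ i j, constantCoeff (A i j) = 0) :
    LinearMap.range A.mulVecLin ≤ irrelevantIdeal k •
      (⊤ : Submodule (MvPolynomial (Fin 4) k) (Fin n → MvPolynomial (Fin 4) k)) := by
  rintro _ ⟨v, rfl⟩
  rw [Matrix.mulVecLin_apply, pi_eq_sum_univ' (A.mulVec v)]
  refine Submodule.sum_mem _ fun i _ => Submodule.smul_mem_smul ?_ trivial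
  change ∑ j, A i j * v j ∈ irrelevantIdeal k
  exact Ideal.sum_mem _ fun j _ => Ideal.mul_mem_right _ _ (mem_irrelevantIdeal.mpr (hA i j))

lemma linearCombination_mem_irrelevantIdeal_smul_top {n : ℕ} {A : Fin n → MvPolynomial (Fin 4) k}
    (hA : ∀ i, constantCoeff (A i) = 0) :
    LinearMap.range (Fintype.linearCombination (MvPolynomial (Fin 4) k) A) ≤ irrelevantIdeal k •
      (⊤ : Submodule (MvPolynomial (Fin 4) k) (MvPolynomial (Fin 4) k)) := by
  rintro _ ⟨v, rfl⟩
  rw [Fintype.linearCombination_apply, smul_eq_mul, Ideal.mul_top]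
  exact Ideal.sum_mem _ fun j _ => Ideal.mul_mem_left _ _ (mem_irrelevantIdeal.mpr (hA j))

end PolynomialRing

/-! ### Exactness of the three complexes. -/

section Exactness

variable {R : Type*} [CommRing R] {x₀ x₁ x₂ y : R} {a : ℕ}

lemma linearCombination_phi1_1 (v : Fin 6 → R) :
    Fintype.linearCombination R (phi1_1 a x₀ x₁ x₂ y) v =
      v 0 * (x₁ ^ 2 - x₀ * x₂) + v 1 * (x₁ * x₂ - x₀ * y) + v 2 * (x₂ ^ 2 - x₁ * y) +
        (v 3 * x₁ + v 4 * x₂ + v 5 * y) * y ^ a := by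
  simp [Fintype.linearCombination_apply, phi1_1, Fin.sum_univ_succ]
  ring

lemma mulVec_phi2_1 (v : Fin 8 → R) :
    (phi2_1 a x₀ x₁ x₂ y).mulVec v =
      ![x₂ * v 0 + y ^ a * v 1 - y * v 2, -x₁ * v 0 + x₂ * v 2 + y ^ a * v 3,
        x₀ * v 0 - x₁ * v 2 + y ^ a * v 4, -x₁ * v 1 - x₂ * v 3 + x₂ * v 5 + y * v 6,
        x₀ * v 1 - x₂ * v 4 - x₁ * v 5 + y * v 7, x₀ * v 3 + x₁ * v 4 - x₁ * v 6 - x₂ * v 7] := by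
  ext i
  fin_cases i <;> simp [phi2_1, Matrix.mulVec, dotProduct, Fin.sum_univ_eight] <;> ring

lemma mulVec_phi3_1 (v : Fin 3 → R) :
    (phi3_1 a x₀ x₁ x₂ y).mulVec v =
      ![y ^ a * v 0, -x₂ * v 0 + y * v 1, y ^ a * v 1, x₁ * v 0 - x₂ * v 1, -x₀ * v 0 + x₁ * v 1,
        -x₂ * v 1 + y * v 2, x₁ * v 1 - x₂ * v 2, -x₀ * v 1 + x₁ * v 2] := by
  ext i
  fin_cases i <;> simp [phi3_1, Matrix.mulVec, dotProduct, Fin.sum_univ_three] <;> ring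

lemma linearCombination_phi1_2 (v : Fin 5 → R) :
    Fintype.linearCombination R (phi1_2 a x₀ x₁ x₂ y) v =
      v 0 * (x₁ ^ 2 - x₀ * x₂) + v 1 * (x₁ * x₂ - x₀ * y) + v 2 * (x₂ ^ 2 - x₁ * y) +
        (v 3 * x₂ + v 4 * y) * y ^ a := by
  simp [Fintype.linearCombination_apply, phi1_2, Fin.sum_univ_succ]
  ring

lemma mulVec_phi2_2 (v : Fin 5 → R) :
    (phi2_2 a x₀ x₁ x₂ y).mulVec v =
      ![x₂ * v 0 - y * v 1, -x₁ * v 0 + x₂ * v 1 + y ^ a * v 2,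
        x₀ * v 0 - x₁ * v 1 + y ^ a * v 3, -x₁ * v 2 - x₂ * v 3 + y * v 4,
        x₀ * v 2 + x₁ * v 3 - x₂ * v 4] := by
  ext i
  fin_cases i <;> simp [phi2_2, Matrix.mulVec, dotProduct, Fin.sum_univ_five] <;> ring

lemma mulVec_phi3_2 (v : Fin 1 → R) :
    (phi3_2 a x₀ x₁ x₂ y).mulVec v =
      ![y ^ (a + 1) * v 0, x₂ * y ^ a * v 0, -(x₂ ^ 2 - x₁ * y) * v 0, (x₁ * x₂ - x₀ * y) * v 0,
        (x₁ ^ 2 - x₀ * x₂) * v 0] := by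
  ext i
  fin_cases i <;> simp [phi3_2, Matrix.mulVec, dotProduct]
  ring

lemma linearCombination_phi1_3 (v : Fin 4 → R) :
    Fintype.linearCombination R (phi1_3 a x₀ x₁ x₂ y) v =
      v 0 * (x₁ ^ 2 - x₀ * x₂) + v 1 * (x₁ * x₂ - x₀ * y) + v 2 * (x₂ ^ 2 - x₁ * y) +
        v 3 * y ^ (a + 1) := by
  simp [Fintype.linearCombination_apply, phi1_3, Fin.sum_univ_succ]
  ring

lemma mulVec_phi2_3 (v : Fin 5 → R) :
    (phi2_3 a x₀ x₁ x₂ y).mulVec v =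
      ![x₂ * v 0 + y ^ (a + 1) * v 1 - y * v 2, -x₁ * v 0 + x₂ * v 2 + y ^ (a + 1) * v 3,
        x₀ * v 0 - x₁ * v 2 + y ^ (a + 1) * v 4,
        -((x₁ ^ 2 - x₀ * x₂) * v 1 + (x₁ * x₂ - x₀ * y) * v 3 + (x₂ ^ 2 - x₁ * y) * v 4)] := by
  ext i
  fin_cases i <;> simp [phi2_3, Matrix.mulVec, dotProduct, Fin.sum_univ_five]
  all_goals ring

lemma mulVec_phi3_3 (v : Fin 2 → R) :
    (phi3_3 a x₀ x₁ x₂ y).mulVec v =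
      ![y ^ (a + 1) * v 0, -x₂ * v 0 + y * v 1, y ^ (a + 1) * v 1, x₁ * v 0 - x₂ * v 1,
        -x₀ * v 0 + x₁ * v 1] := by
  ext i
  fin_cases i <;> simp [phi3_3, Matrix.mulVec, dotProduct, Fin.sum_univ_two]
  all_goals ring

namespace IsIndependentQuadruple

variable [IsDomain R]

lemma exact_phi2_1_phi1_1 (h : IsIndependentQuadruple x₀ x₁ x₂ y) :
    Function.Exact (phi2_1 a x₀ x₁ x₂ y).mulVecLin
      (Fintype.linearCombination R (phi1_1 a x₀ x₁ x₂ y)) := by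
  intro v
  constructor
  · intro hv
    rw [linearCombination_phi1_1] at hv
    obtain ⟨u₁, u₂, w₁, w₂, w₃, h0, h1, h2, hf⟩ := h.syzygies_minors_pow hv
    -- Each minor is written in terms of `x₁, x₂, y`, for instance `g₁ = x₁ * x₁ - x₀ * x₂`; the
    -- difference from `v 3, v 4, v 5` is then a Koszul relation.
    obtain ⟨p, q, c, h3, h4, h5⟩ := h.koszul_three (r := v 3 - (x₁ * w₁ + x₂ * w₂))
      (s := v 4 - (-x₀ * w₁ + x₂ * w₃)) (t := v 5 - (-x₀ * w₂ - x₁ * w₃))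
      (by linear_combination hf)
    refine ⟨![u₁, -w₁, u₂, -w₂, -w₃, p, q, c], ?_⟩
    rw [Matrix.mulVecLin_apply, mulVec_phi2_1]
    ext i
    fin_cases i <;> simp
    · linear_combination -h0
    · linear_combination -h1
    · linear_combination -h2
    · linear_combination -h3
    · linear_combination -h4
    · linear_combination -h5
  · rintro ⟨w, rfl⟩
    rw [Matrix.mulVecLin_apply, mulVec_phi2_1, linearCombination_phi1_1]
    simp
    ring

lemma exact_phi3_1_phi2_1 (h : IsIndependentQuadruple x₀ x₁ x₂ y) :
    Function.Exact (phi3_1 a x₀ x₁ x₂ y).mulVecLin (phi2_1 a x₀ x₁ x₂ y).mulVecLin := by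
  intro v
  constructor
  · intro hv
    rw [Matrix.mulVecLin_apply, mulVec_phi2_1] at hv
    obtain ⟨c₁, c₂, h0, h1, h2, h3, h4⟩ :=
      h.hilbertBurch_pow (congrFun hv 0) (congrFun hv 1) (congrFun hv 2)
    have e3 : -x₁ * v 1 - x₂ * v 3 + x₂ * v 5 + y * v 6 = 0 := congrFun hv 3
    have e4 : x₀ * v 1 - x₂ * v 4 - x₁ * v 5 + y * v 7 = 0 := congrFun hv 4
    rw [h1, h3] at e3
    rw [h1, h4] at e4
    -- After substitution `c₁` cancels from the fourth row, leaving a relation between `x₂` and `y`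
    -- alone.
    obtain ⟨p, h5, h6⟩ := h.koszul_two (s := v 5 + x₂ * c₂) (t := v 6 - x₁ * c₂)
      (by linear_combination e3)
    have h7 : v 7 = -x₀ * c₂ + x₁ * p :=
      mul_left_cancel₀ h.prime.ne_zero (by linear_combination e4 + x₁ * h5)
    refine ⟨![c₁, c₂, p], ?_⟩
    rw [Matrix.mulVecLin_apply, mulVec_phi3_1]
    ext i
    fin_cases i <;> simp
    · exact h0.symm
    · linear_combination -h1
    · exact h2.symm
    · exact h3.symm
    · linear_combination -h4
    · linear_combination -h5
    · linear_combination -h6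
    · linear_combination -h7
  · rintro ⟨w, rfl⟩
    simp only [Matrix.mulVecLin_apply, mulVec_phi2_1, mulVec_phi3_1]
    ext i
    fin_cases i <;> simp <;> ring

lemma injective_phi3_1 (h : IsIndependentQuadruple x₀ x₁ x₂ y) :
    Function.Injective (phi3_1 a x₀ x₁ x₂ y).mulVecLin := by
  have hy : y ^ a ≠ 0 := pow_ne_zero a h.prime.ne_zero
  refine (injective_iff_map_eq_zero _).mpr fun v hv => ?_
  rw [Matrix.mulVecLin_apply, mulVec_phi3_1] at hv
  have h0 : v 0 = 0 := (mul_eq_zero.mp (congrFun hv 0)).resolve_left hy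
  have h1 : v 1 = 0 := (mul_eq_zero.mp (congrFun hv 2)).resolve_left hy
  have h5 : -x₂ * v 1 + y * v 2 = 0 := congrFun hv 5
  have h2 : v 2 = 0 := by
    rw [h1, mul_zero, zero_add] at h5
    exact (mul_eq_zero.mp h5).resolve_left h.prime.ne_zero
  ext i
  fin_cases i
  exacts [h0, h1, h2]

lemma exact_phi2_2_phi1_2 (h : IsIndependentQuadruple x₀ x₁ x₂ y) :
    Function.Exact (phi2_2 a x₀ x₁ x₂ y).mulVecLin
      (Fintype.linearCombination R (phi1_2 a x₀ x₁ x₂ y)) := by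
  intro v
  constructor
  · intro hv
    rw [linearCombination_phi1_2] at hv
    obtain ⟨u₁, u₂, w₁, w₂, w₃, h0, h1, h2, hf⟩ := h.syzygies_minors_pow hv
    -- Unlike `g₂` and `g₃`, the minor `g₁` is not in `(x₂, y)`. Its coefficient is, so `t₁`, `t₂`
    -- times the Hilbert-Burch columns remove it; the same correction, times `y ^ a`, enters the
    -- first two witnesses below.
    obtain ⟨t₁, t₂, ht⟩ := h.exists_first_coeff (w₁ := w₁) (w₂ := w₂) (w₃ := w₃) (p := v 3)
      (q := v 4) (by linear_combination -hf)
    rw [ht] at h0 hf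
    obtain ⟨c, h3, h4⟩ := h.koszul_two
      (s := v 3 - (x₁ * (w₂ + t₁ * x₁ - t₂ * x₂) + x₂ * (w₃ - t₁ * x₀ + t₂ * x₁)))
      (t := v 4 + x₀ * (w₂ + t₁ * x₁ - t₂ * x₂) + x₁ * (w₃ - t₁ * x₀ + t₂ * x₁))
      (by linear_combination hf)
    refine ⟨![u₁ - t₁ * y ^ a, u₂ - t₂ * y ^ a, -(w₂ + t₁ * x₁ - t₂ * x₂),
      -(w₃ - t₁ * x₀ + t₂ * x₁), c], ?_⟩
    rw [Matrix.mulVecLin_apply, mulVec_phi2_2]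
    ext i
    fin_cases i <;> simp
    · linear_combination -h0
    · linear_combination -h1
    · linear_combination -h2
    · linear_combination -h3
    · linear_combination -h4
  · rintro ⟨w, rfl⟩
    rw [Matrix.mulVecLin_apply, mulVec_phi2_2, linearCombination_phi1_2]
    simp
    ring

lemma exact_phi3_2_phi2_2 (h : IsIndependentQuadruple x₀ x₁ x₂ y) :
    Function.Exact (phi3_2 a x₀ x₁ x₂ y).mulVecLin (phi2_2 a x₀ x₁ x₂ y).mulVecLin := by
  have hy : y ^ a ≠ 0 := pow_ne_zero a h.prime.ne_zero
  intro v
  constructor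
  · intro hv
    rw [Matrix.mulVecLin_apply, mulVec_phi2_2] at hv
    have e0 : x₂ * v 0 - y * v 1 = 0 := congrFun hv 0
    have e1 : -x₁ * v 0 + x₂ * v 1 + y ^ a * v 2 = 0 := congrFun hv 1
    have e2 : x₀ * v 0 - x₁ * v 1 + y ^ a * v 3 = 0 := congrFun hv 2
    have e3 : -x₁ * v 2 - x₂ * v 3 + y * v 4 = 0 := congrFun hv 3
    -- The first row forces `(v 0, v 1) = p * (y, x₂)`; the second then makes `y ^ a` divide `g₃ *
    -- p`, hence `p`.
    obtain ⟨p, h0, h1⟩ := h.koszul_two (s := v 0) (t := -v 1) (by linear_combination e0)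
    obtain ⟨c, rfl⟩ := h.pow_dvd_of_dvd_minor_mul (n := a) (w := p)
      ⟨-v 2, by linear_combination e1 + x₁ * h0 + x₂ * h1⟩
    have h2 : v 2 = -(x₂ ^ 2 - x₁ * y) * c :=
      mul_left_cancel₀ hy (by linear_combination e1 + x₁ * h0 + x₂ * h1)
    have h3 : v 3 = (x₁ * x₂ - x₀ * y) * c :=
      mul_left_cancel₀ hy (by linear_combination e2 - x₀ * h0 - x₁ * h1)
    have h4 : v 4 = (x₁ ^ 2 - x₀ * x₂) * c :=
      mul_left_cancel₀ h.prime.ne_zero (by linear_combination e3 + x₁ * h2 + x₂ * h3)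
    refine ⟨![c], ?_⟩
    rw [Matrix.mulVecLin_apply, mulVec_phi3_2]
    ext i
    fin_cases i <;> simp
    · linear_combination -h0
    · linear_combination h1
    · linear_combination -h2
    · linear_combination -h3
    · linear_combination -h4
  · rintro ⟨w, rfl⟩
    simp only [Matrix.mulVecLin_apply, mulVec_phi2_2, mulVec_phi3_2]
    ext i
    fin_cases i <;> simp <;> ring

lemma injective_phi3_2 (h : IsIndependentQuadruple x₀ x₁ x₂ y) :
    Function.Injective (phi3_2 a x₀ x₁ x₂ y).mulVecLin := by
  refine (injective_iff_map_eq_zero _).mpr fun v hv => ?_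
  rw [Matrix.mulVecLin_apply, mulVec_phi3_2] at hv
  have h0 : v 0 = 0 :=
    (mul_eq_zero.mp (congrFun hv 0)).resolve_left (pow_ne_zero _ h.prime.ne_zero)
  ext i
  fin_cases i
  exact h0

lemma exact_phi2_3_phi1_3 (h : IsIndependentQuadruple x₀ x₁ x₂ y) :
    Function.Exact (phi2_3 a x₀ x₁ x₂ y).mulVecLin
      (Fintype.linearCombination R (phi1_3 a x₀ x₁ x₂ y)) := by
  intro v
  constructor
  · intro hv
    rw [linearCombination_phi1_3] at hv
    obtain ⟨u₁, u₂, w₁, w₂, w₃, h0, h1, h2, h3⟩ := h.syzygies_minors_pow hv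
    refine ⟨![u₁, -w₁, u₂, -w₂, -w₃], ?_⟩
    rw [Matrix.mulVecLin_apply, mulVec_phi2_3]
    ext i
    fin_cases i <;> simp
    · linear_combination -h0
    · linear_combination -h1
    · linear_combination -h2
    · linear_combination -h3
  · rintro ⟨w, rfl⟩
    rw [Matrix.mulVecLin_apply, mulVec_phi2_3, linearCombination_phi1_3]
    simp
    ring

lemma exact_phi3_3_phi2_3 (h : IsIndependentQuadruple x₀ x₁ x₂ y) :
    Function.Exact (phi3_3 a x₀ x₁ x₂ y).mulVecLin (phi2_3 a x₀ x₁ x₂ y).mulVecLin := by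
  intro v
  constructor
  · intro hv
    rw [Matrix.mulVecLin_apply, mulVec_phi2_3] at hv
    obtain ⟨c₁, c₂, h0, h1, h2, h3, h4⟩ :=
      h.hilbertBurch_pow (congrFun hv 0) (congrFun hv 1) (congrFun hv 2)
    refine ⟨![c₁, c₂], ?_⟩
    rw [Matrix.mulVecLin_apply, mulVec_phi3_3]
    ext i
    fin_cases i
    exacts [h0.symm, h1.symm, h2.symm, h3.symm, h4.symm]
  · rintro ⟨w, rfl⟩
    simp only [Matrix.mulVecLin_apply, mulVec_phi2_3, mulVec_phi3_3]
    ext i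
    fin_cases i <;> simp <;> ring

lemma injective_phi3_3 (h : IsIndependentQuadruple x₀ x₁ x₂ y) :
    Function.Injective (phi3_3 a x₀ x₁ x₂ y).mulVecLin := by
  have hy : y ^ (a + 1) ≠ 0 := pow_ne_zero _ h.prime.ne_zero
  refine (injective_iff_map_eq_zero _).mpr fun v hv => ?_
  rw [Matrix.mulVecLin_apply, mulVec_phi3_3] at hv
  ext i
  fin_cases i
  · exact (mul_eq_zero.mp (congrFun hv 0)).resolve_left hy
  · exact (mul_eq_zero.mp (congrFun hv 2)).resolve_left hy

end IsIndependentQuadruple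

end Exactness

/-! ### Normal forms of monomials modulo the minors. -/

section NormalMonomial

variable {A : Type*} [CommRing A]

/-- The monomial of degree `n` and index sum `s` that contains at most one factor `x₁` or `x₂`. -/
def normalMonomial (x₀ x₁ x₂ y : A) (n s : ℕ) : A :=
  x₀ ^ (n - (s + 2) / 3) * (if s % 3 = 0 then 1 else if s % 3 = 1 then x₁ else x₂) * y ^ (s / 3)

variable {x₀ x₁ x₂ y : A}

lemma normalMonomial_zero (i l : ℕ) :
    normalMonomial x₀ x₁ x₂ y (i + l) (3 * l) = x₀ ^ i * y ^ l := by
  rw [normalMonomial, show i + l - (3 * l + 2) / 3 = i by omega, if_pos (by omega),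
    show 3 * l / 3 = l by omega, mul_one]

lemma normalMonomial_one (i l : ℕ) :
    normalMonomial x₀ x₁ x₂ y (i + l + 1) (3 * l + 1) = x₀ ^ i * x₁ * y ^ l := by
  rw [normalMonomial, show i + l + 1 - (3 * l + 1 + 2) / 3 = i by omega, if_neg (by omega),
    if_pos (by omega), show (3 * l + 1) / 3 = l by omega]

lemma normalMonomial_two (i l : ℕ) :
    normalMonomial x₀ x₁ x₂ y (i + l + 1) (3 * l + 2) = x₀ ^ i * x₂ * y ^ l := by
  rw [normalMonomial, show i + l + 1 - (3 * l + 2 + 2) / 3 = i by omega, if_neg (by omega),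
    if_neg (by omega), show (3 * l + 2) / 3 = l by omega]

/-- The bound `s ≤ 3 * n` ensures that the truncated exponent `n - (s + 2) / 3` of `x₀` is a true
difference, `(s + 2) / 3` being `s / 3` rounded up. -/
lemma exists_index_of_le {n s : ℕ} (h : s ≤ 3 * n) :
    (∃ i l, n = i + l ∧ s = 3 * l) ∨ (∃ i l, n = i + l + 1 ∧ s = 3 * l + 1) ∨
      ∃ i l, n = i + l + 1 ∧ s = 3 * l + 2 := by
  have h3 : s % 3 = 0 ∨ s % 3 = 1 ∨ s % 3 = 2 := by omega
  rcases h3 with h3 | h3 | h3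
  · exact Or.inl ⟨n - s / 3, s / 3, by omega, by omega⟩
  · exact Or.inr (Or.inl ⟨n - s / 3 - 1, s / 3, by omega, by omega⟩)
  · exact Or.inr (Or.inr ⟨n - s / 3 - 1, s / 3, by omega, by omega⟩)

lemma normalMonomial_mul_y {n s : ℕ} (h : s ≤ 3 * n) :
    normalMonomial x₀ x₁ x₂ y n s * y = normalMonomial x₀ x₁ x₂ y (n + 1) (s + 3) := by
  rcases exists_index_of_le h with ⟨i, l, rfl, rfl⟩ | ⟨i, l, rfl, rfl⟩ | ⟨i, l, rfl, rfl⟩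
  · rw [show i + l + 1 = i + (l + 1) by ring, show 3 * l + 3 = 3 * (l + 1) by ring,
      normalMonomial_zero, normalMonomial_zero]
    ring
  · rw [show i + l + 1 + 1 = i + (l + 1) + 1 by ring,
      show 3 * l + 1 + 3 = 3 * (l + 1) + 1 by ring, normalMonomial_one, normalMonomial_one]
    ring
  · rw [show i + l + 1 + 1 = i + (l + 1) + 1 by ring,
      show 3 * l + 2 + 3 = 3 * (l + 1) + 2 by ring, normalMonomial_two, normalMonomial_two]
    ring

lemma normalMonomial_mul_x₁ (h1 : x₁ ^ 2 - x₀ * x₂ = 0) (h2 : x₁ * x₂ - x₀ * y = 0) {n s : ℕ}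
    (h : s ≤ 3 * n) :
    normalMonomial x₀ x₁ x₂ y n s * x₁ = normalMonomial x₀ x₁ x₂ y (n + 1) (s + 1) := by
  rcases exists_index_of_le h with ⟨i, l, rfl, rfl⟩ | ⟨i, l, rfl, rfl⟩ | ⟨i, l, rfl, rfl⟩
  · rw [normalMonomial_zero, normalMonomial_one]
    ring
  · rw [show i + l + 1 + 1 = i + 1 + l + 1 by ring, normalMonomial_one, normalMonomial_two]
    linear_combination x₀ ^ i * y ^ l * h1
  · rw [show i + l + 1 + 1 = i + 1 + (l + 1) by ring,
      show 3 * l + 2 + 1 = 3 * (l + 1) by ring, normalMonomial_two, normalMonomial_zero]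
    linear_combination x₀ ^ i * y ^ l * h2

lemma normalMonomial_mul_x₂ (h2 : x₁ * x₂ - x₀ * y = 0) (h3 : x₂ ^ 2 - x₁ * y = 0) {n s : ℕ}
    (h : s ≤ 3 * n) :
    normalMonomial x₀ x₁ x₂ y n s * x₂ = normalMonomial x₀ x₁ x₂ y (n + 1) (s + 2) := by
  rcases exists_index_of_le h with ⟨i, l, rfl, rfl⟩ | ⟨i, l, rfl, rfl⟩ | ⟨i, l, rfl, rfl⟩
  · rw [normalMonomial_zero, normalMonomial_two]
    ring
  · rw [show i + l + 1 + 1 = i + 1 + (l + 1) by ring,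
      show 3 * l + 1 + 2 = 3 * (l + 1) by ring, normalMonomial_one, normalMonomial_zero]
    linear_combination x₀ ^ i * y ^ l * h2
  · rw [show i + l + 1 + 1 = i + (l + 1) + 1 by ring,
      show 3 * l + 2 + 2 = 3 * (l + 1) + 1 by ring, normalMonomial_two, normalMonomial_one]
    linear_combination x₀ ^ i * y ^ l * h3

/-- Each minor exchanges two quadratic monomials of equal index sum, so a product can be
straightened one factor at a time. -/
lemma monomial_eq_normalMonomial (h1 : x₁ ^ 2 - x₀ * x₂ = 0) (h2 : x₁ * x₂ - x₀ * y = 0)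
    (h3 : x₂ ^ 2 - x₁ * y = 0) (p q r t : ℕ) :
    x₀ ^ p * x₁ ^ q * x₂ ^ r * y ^ t =
      normalMonomial x₀ x₁ x₂ y (p + q + r + t) (q + 2 * r + 3 * t) := by
  induction t with
  | succ t ih =>
    rw [pow_succ, ← mul_assoc, ih, normalMonomial_mul_y (by omega)]
    ring_nf
  | zero =>
    induction r with
    | succ r ih =>
      rw [pow_zero, mul_one] at ih ⊢
      rw [pow_succ, ← mul_assoc, ih, normalMonomial_mul_x₂ h2 h3 (by omega)]
      ring_nf
    | zero =>
      induction q with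
      | succ q ih =>
        simp only [pow_zero, mul_one] at ih ⊢
        rw [pow_succ, ← mul_assoc, ih, normalMonomial_mul_x₁ h1 h2 (by omega)]
        ring_nf
      | zero => simpa using (normalMonomial_zero (x₀ := x₀) (x₁ := x₁) (x₂ := x₂) (y := y) p 0).symm

/-- Either the exponent of `y` exceeds `a`, or it equals `a` and the residue `s % 3` is at least
`b`, so the inner factor is an `xᵢ` with `i ≥ b`. -/
lemma normalMonomial_eq_zero {a b n s : ℕ} (hb : b ≤ 3) (h1 : b ≤ 1 → x₁ * y ^ a = 0)
    (h2 : b ≤ 2 → x₂ * y ^ a = 0) (hy : y ^ (a + 1) = 0) (hs : 3 * a + b ≤ s) (hb0 : 1 ≤ b) :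
    normalMonomial x₀ x₁ x₂ y n s = 0 := by
  by_cases hl : a + 1 ≤ s / 3
  · rw [normalMonomial, pow_eq_zero_of_le hl hy, mul_zero]
  · have hl : s / 3 = a := by omega
    rw [normalMonomial, if_neg (by omega), hl, mul_assoc]
    split_ifs with h
    · rw [h1 (by omega), mul_zero]
    · rw [h2 (by omega), mul_zero]

end NormalMonomial

/-! ### Least forms and the tangent cone ideal. -/

section TangentCone

variable {k : Type*} [Field k]

/-- The index sum of a monomial, where `x₀, x₁, x₂, y` have the indices `0, 1, 2, 3`. -/
def indexSum (e : Fin 4 →₀ ℕ) : ℕ := e 1 + 2 * e 2 + 3 * e 3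

/-- Modulo `I`, a form of degree `n` collapses to one term per index sum `s`, whose coefficient
vanishes for `s < c` and whose normal monomial vanishes for `s ≥ c`. -/
lemma mem_of_sum_coeff_eq_zero {I : Ideal (MvPolynomial (Fin 4) k)} {c n : ℕ}
    (h1 : X 1 ^ 2 - X 0 * X 2 ∈ I) (h2 : X 1 * X 2 - X 0 * X 3 ∈ I) (h3 : X 2 ^ 2 - X 1 * X 3 ∈ I)
    (hI : ∀ s, c ≤ s → normalMonomial (X 0) (X 1) (X 2) (X 3) n s ∈ I)
    {f : MvPolynomial (Fin 4) k} (hf : f.IsHomogeneous n)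
    (hc : ∀ s < c, ∑ e ∈ f.support with indexSum e = s, coeff e f = 0) : f ∈ I := by
  classical
  set π := Ideal.Quotient.mk I
  have hπ : ∀ {g}, g ∈ I → π g = 0 := fun hg => Ideal.Quotient.eq_zero_iff_mem.mpr hg
  set N : ℕ → MvPolynomial (Fin 4) k ⧸ I :=
    normalMonomial (π (X 0)) (π (X 1)) (π (X 2)) (π (X 3)) n with hN
  have hN0 : ∀ s, c ≤ s → N s = 0 := by
    intro s hs
    rw [← hπ (hI s hs), hN]
    unfold normalMonomial
    split_ifs <;> simp
  have hmon : ∀ e ∈ f.support, π (monomial e (coeff e f)) = π (C (coeff e f)) * N (indexSum e) := by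
    intro e he
    have hdeg : e 0 + e 1 + e 2 + e 3 = n := by
      have : e.degree = n := by
        rw [Finsupp.degree_eq_weight_one]
        exact hf (mem_support_iff.mp he)
      rw [Finsupp.degree_eq_sum, Fin.sum_univ_four] at this
      exact this
    have h0 := monomial_eq_normalMonomial (x₀ := π (X 0)) (x₁ := π (X 1)) (x₂ := π (X 2))
      (y := π (X 3)) (by simpa using hπ h1) (by simpa using hπ h2) (by simpa using hπ h3)
      (e 0) (e 1) (e 2) (e 3)
    rw [hdeg] at h0
    rw [hN, indexSum, ← h0, monomial_eq, Finsupp.prod_fintype _ _ (by simp), Fin.prod_univ_four]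
    simp
  refine Ideal.Quotient.eq_zero_iff_mem.mp ?_
  change π f = 0
  rw [f.as_sum, map_sum, Finset.sum_congr rfl hmon,
    ← Finset.sum_fiberwise_of_maps_to (g := indexSum) (t := f.support.image indexSum)
      fun e he => Finset.mem_image_of_mem _ he]
  refine Finset.sum_eq_zero fun s _ => ?_
  rw [Finset.sum_congr rfl (g := fun e => π (C (coeff e f)) * N s)
    fun e he => by rw [(Finset.mem_filter.mp he).2], ← Finset.sum_mul, ← map_sum, ← map_sum]
  rcases lt_or_ge s c with hs | hs
  · rw [hc s hs, map_zero, map_zero, zero_mul]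
  · rw [hN0 s hs, mul_zero]

lemma coeff_param (m : Fin 4 → ℕ) (f : MvPolynomial (Fin 4) k) (w : ℕ) :
    (param k m f).coeff w = ∑ e ∈ f.support with ∑ i, e i * m i = w, coeff e f := by
  classical
  conv_lhs => rw [f.as_sum]
  rw [map_sum, Polynomial.finsetSum_coeff, Finset.sum_filter]
  refine Finset.sum_congr rfl fun e _ => ?_
  rw [param, aeval_monomial, Finsupp.prod_fintype _ _ (by simp)]
  simp_rw [← pow_mul]
  rw [Finset.prod_pow_eq_pow_sum, Polynomial.algebraMap_eq, Polynomial.coeff_C_mul_X_pow]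
  simp_rw [mul_comm, eq_comm]

lemma weight_eq {d : ℕ} {m : Fin 4 → ℕ} (hm : ∀ i : Fin 4, m i = m 0 + (i : ℕ) * d)
    (e : Fin 4 →₀ ℕ) : ∑ i, e i * m i = e.degree * m 0 + indexSum e * d := by
  rw [Finsupp.degree_eq_sum, Fin.sum_univ_four, Fin.sum_univ_four, hm 1, hm 2, hm 3, indexSum]
  simp
  ring

lemma coprime_of_gcd_eq_one {d : ℕ} {m : Fin 4 → ℕ}
    (hm : ∀ i : Fin 4, m i = m 0 + (i : ℕ) * d) (hgcd : Finset.univ.gcd m = 1) :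
    Nat.Coprime (m 0) d := by
  refine Nat.dvd_one.mp (hgcd ▸ Finset.dvd_gcd fun i _ => ?_)
  rw [hm i]
  exact dvd_add (Nat.gcd_dvd_left _ _) (dvd_mul_of_dvd_right (Nat.gcd_dvd_right _ _) _)

/-- From `(n' - n) * c = (s - s') * d` with `c` prime to `d`, the number `c` divides `s - s'`, which
is smaller than `c`. -/
lemma eq_of_weight_eq {c d n n' s s' : ℕ} (hcop : Nat.Coprime c d) (hs : s < c)
    (hn : n ≤ n') (h : n' * c + s' * d = n * c + s * d) (hd : 1 ≤ d) : n' = n ∧ s' = s := by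
  obtain ⟨j, rfl⟩ := Nat.exists_eq_add_of_le hn
  have h' : j * c + s' * d = s * d := by linarith
  have hle : s' ≤ s := Nat.le_of_mul_le_mul_right (by omega) hd
  obtain ⟨r, rfl⟩ := Nat.exists_eq_add_of_le hle
  have hr : r * d = j * c := by linarith
  have hr0 : r = 0 :=
    Nat.eq_zero_of_dvd_of_lt (hcop.dvd_of_dvd_mul_right ⟨j, by rw [hr, mul_comm]⟩) (by omega)
  subst hr0
  have : j = 0 := by
    rw [zero_mul, eq_comm, mul_eq_zero] at hr
    exact hr.resolve_right (by omega)
  exact ⟨by omega, by omega⟩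

lemma sum_coeff_leastForm_eq_zero {d : ℕ} {m : Fin 4 → ℕ} (hd : 1 ≤ d)
    (hm : ∀ i : Fin 4, m i = m 0 + (i : ℕ) * d) (hgcd : Finset.univ.gcd m = 1)
    {f : MvPolynomial (Fin 4) k} (hf : f ∈ curveIdeal k m) {s : ℕ} (hs : s < m 0) :
    ∑ e ∈ (leastForm f).support with indexSum e = s, coeff e (leastForm f) = 0 := by
  classical
  -- For `f = 0` this infimum of the empty set is `0`, which is harmless because the support is
  -- empty.
  set n := sInf {n : ℕ | homogeneousComponent n f ≠ 0} with hn
  have hle : ∀ e ∈ f.support, n ≤ e.degree := by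
    intro e he
    refine Nat.sInf_le fun h0 => mem_support_iff.mp he ?_
    have := congrArg (coeff e) h0
    rwa [coeff_homogeneousComponent, if_pos rfl, coeff_zero] at this
  have hl : ∀ e, coeff e (leastForm f) = if e.degree = n then coeff e f else 0 :=
    fun e => coeff_homogeneousComponent n f e
  -- The vanishing coefficient at this weight collects exactly the monomials of degree `n` and index
  -- sum `s`.
  have hz : (param k m f).coeff (n * m 0 + s * d) = 0 := by
    rw [show param k m f = 0 from hf, Polynomial.coeff_zero]
  rw [coeff_param] at hz
  rw [← hz]
  refine Finset.sum_congr ?_ ?_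
  · ext e
    simp only [Finset.mem_filter, mem_support_iff, hl, weight_eq hm, ne_eq, ite_eq_right_iff,
      Classical.not_imp]
    constructor
    · rintro ⟨⟨h1, h2⟩, h3⟩
      exact ⟨h2, by rw [h1, h3]⟩
    · rintro ⟨h1, h2⟩
      obtain ⟨h3, h4⟩ := eq_of_weight_eq (coprime_of_gcd_eq_one hm hgcd) hs
        (hle e (mem_support_iff.mpr h1)) h2 hd
      exact ⟨⟨h3, h1⟩, h4⟩
  · intro e he
    rw [Finset.mem_filter, weight_eq hm] at he
    rw [hl, if_pos (eq_of_weight_eq (coprime_of_gcd_eq_one hm hgcd) hs (hle e he.1) he.2 hd).1]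

lemma tangentConeIdeal_le {a b d : ℕ} {m : Fin 4 → ℕ} (hb : b ∈ Set.Icc 1 3) (hd : 1 ≤ d)
    (hm₀ : m 0 = 3 * a + b) (hm : ∀ i : Fin 4, m i = m 0 + (i : ℕ) * d)
    (hgcd : Finset.univ.gcd m = 1) {I : Ideal (MvPolynomial (Fin 4) k)}
    (h1 : X 1 ^ 2 - X 0 * X 2 ∈ I) (h2 : X 1 * X 2 - X 0 * X 3 ∈ I) (h3 : X 2 ^ 2 - X 1 * X 3 ∈ I)
    (h4 : b ≤ 1 → X 1 * X 3 ^ a ∈ I) (h5 : b ≤ 2 → X 2 * X 3 ^ a ∈ I) (h6 : X 3 ^ (a + 1) ∈ I) :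
    tangentConeIdeal k m ≤ I := by
  refine Ideal.span_le.mpr ?_
  rintro _ ⟨f, hf, rfl⟩
  refine mem_of_sum_coeff_eq_zero h1 h2 h3 (c := m 0) (fun s hs => ?_)
    (homogeneousComponent_isHomogeneous _ f)
    fun s hs => sum_coeff_leastForm_eq_zero hd hm hgcd hf hs
  rw [← Ideal.Quotient.eq_zero_iff_mem] at h6 ⊢
  simp only [← Ideal.Quotient.eq_zero_iff_mem] at h4 h5
  set π := Ideal.Quotient.mk I
  refine Eq.trans ?_ (normalMonomial_eq_zero (x₀ := π (X 0)) (x₁ := π (X 1)) (x₂ := π (X 2))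
    (y := π (X 3)) (a := a) (b := b) (n := sInf {n : ℕ | homogeneousComponent n f ≠ 0}) (s := s)
    hb.2 (fun h => by simpa using h4 h) (fun h => by simpa using h5 h) (by simpa using h6)
    (by omega) hb.1)
  unfold normalMonomial
  split_ifs <;> simp

lemma leastForm_sub {p q : MvPolynomial (Fin 4) k} {n n' : ℕ} (hp : p.IsHomogeneous n)
    (hq : q.IsHomogeneous n') (hn : n < n') (hp0 : p ≠ 0) : leastForm (p - q) = p := by
  have hcomp : ∀ j ≤ n, homogeneousComponent j (p - q) = if j = n then p else 0 := by
    intro j hj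
    rw [map_sub, homogeneousComponent_of_mem hp, homogeneousComponent_of_mem hq,
      if_neg (show j ≠ n' by omega), sub_zero]
  have hs : sInf {j : ℕ | homogeneousComponent j (p - q) ≠ 0} = n := by
    have hmem : n ∈ {j : ℕ | homogeneousComponent j (p - q) ≠ 0} := by
      rw [Set.mem_ofPred_eq, hcomp n le_rfl, if_pos rfl]
      exact hp0
    refine le_antisymm (Nat.sInf_le hmem) (le_csInf ⟨n, hmem⟩ fun j hj => ?_)
    by_contra! hlt
    exact hj (by rw [hcomp j hlt.le, if_neg hlt.ne])
  rw [leastForm, hs, hcomp n le_rfl, if_pos rfl]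

lemma mem_tangentConeIdeal {m : Fin 4 → ℕ} {p q : MvPolynomial (Fin 4) k} {n n' : ℕ}
    (hp : p.IsHomogeneous n) (hq : q.IsHomogeneous n') (hn : n < n')
    (h : param k m p = param k m q) : p ∈ tangentConeIdeal k m := by
  by_cases hp0 : p = 0
  · rw [hp0]
    exact Ideal.zero_mem _
  · refine Ideal.subset_span ⟨p - q, ?_, (leastForm_sub hp hq hn hp0).symm⟩
    rw [curveIdeal, RingHom.mem_ker, map_sub, h, sub_self]

end TangentCone

/-! ### Generators of the tangent cone ideal and assembly of the resolutions. -/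

section Resolution

variable {k : Type*} [Field k] {a b d : ℕ} {m : Fin 4 → ℕ}

lemma exact_linearCombination_mk {n : ℕ} {I : Ideal (MvPolynomial (Fin 4) k)}
    {A : Fin n → MvPolynomial (Fin 4) k} (hI : I = Ideal.span (Set.range A)) :
    Function.Exact (Fintype.linearCombination (MvPolynomial (Fin 4) k) A)
      (Ideal.Quotient.mk I) := by
  intro f
  rw [Ideal.Quotient.eq_zero_iff_mem, hI, ← LinearMap.coe_range, Fintype.range_linearCombination]
  rfl

lemma isHomogeneous_sq_sub_mul (i j l : Fin 4) :
    (X i ^ 2 - X j * X l : MvPolynomial (Fin 4) k).IsHomogeneous 2 :=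
  (isHomogeneous_X_pow i 2).sub ((isHomogeneous_X k j).mul (isHomogeneous_X k l))

lemma isHomogeneous_mul_sub_mul (i i' j l : Fin 4) :
    (X i * X i' - X j * X l : MvPolynomial (Fin 4) k).IsHomogeneous 2 :=
  ((isHomogeneous_X k i).mul (isHomogeneous_X k i')).sub
    ((isHomogeneous_X k j).mul (isHomogeneous_X k l))

lemma isHomogeneous_neg_sq_add_mul (i j l : Fin 4) :
    (-X i ^ 2 + X j * X l : MvPolynomial (Fin 4) k).IsHomogeneous 2 :=
  (isHomogeneous_X_pow i 2).neg.add ((isHomogeneous_X k j).mul (isHomogeneous_X k l))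

lemma isHomogeneous_neg_mul_add_mul (i i' j l : Fin 4) :
    (-(X i * X i') + X j * X l : MvPolynomial (Fin 4) k).IsHomogeneous 2 :=
  ((isHomogeneous_X k i).mul (isHomogeneous_X k i')).neg.add
    ((isHomogeneous_X k j).mul (isHomogeneous_X k l))

lemma isHomogeneous_X_mul_X_pow (i j : Fin 4) (n : ℕ) :
    (X i * X j ^ n : MvPolynomial (Fin 4) k).IsHomogeneous (n + 1) := by
  rw [add_comm]
  exact (isHomogeneous_X k i).mul (isHomogeneous_X_pow j n)

lemma minors_mem_tangentConeIdeal (hm : ∀ i : Fin 4, m i = m 0 + (i : ℕ) * d) :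
    (X 1 ^ 2 - X 0 * X 2 ∈ tangentConeIdeal k m ∧ X 1 * X 2 - X 0 * X 3 ∈ tangentConeIdeal k m) ∧
      X 2 ^ 2 - X 1 * X 3 ∈ tangentConeIdeal k m := by
  refine ⟨⟨?_, ?_⟩, ?_⟩
  -- The zero polynomial is homogeneous of every degree; `3` is just one above that of the minors.
  · refine mem_tangentConeIdeal (q := 0) (isHomogeneous_sq_sub_mul 1 0 2)
      (isHomogeneous_zero _ _ 3) (by norm_num) ?_
    simp [param, hm 1, hm 2]
    ring
  · refine mem_tangentConeIdeal (q := 0) (isHomogeneous_mul_sub_mul 1 2 0 3)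
      (isHomogeneous_zero _ _ 3) (by norm_num) ?_
    simp [param, hm 1, hm 2, hm 3]
    ring
  · refine mem_tangentConeIdeal (q := 0) (isHomogeneous_sq_sub_mul 2 1 3)
      (isHomogeneous_zero _ _ 3) (by norm_num) ?_
    simp [param, hm 1, hm 2, hm 3]
    ring

/-- Trading `xᵢ y^a` for `xⱼ x₀^(a+d)` lowers the weight by `(i - j) d + 3 a d = (3a + b) d` and
restores it through `d` extra factors `x₀`; as `d ≥ 1`, the first monomial has the smaller degree.
-/
lemma mul_pow_mem_tangentConeIdeal (hd : 1 ≤ d) (hm₀ : m 0 = 3 * a + b)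
    (hm : ∀ i : Fin 4, m i = m 0 + (i : ℕ) * d) {i j : Fin 4} (hij : (i : ℕ) = b + j) :
    X i * X 3 ^ a ∈ tangentConeIdeal k m := by
  refine mem_tangentConeIdeal (q := X j * X 0 ^ (a + d)) (isHomogeneous_X_mul_X_pow i 3 a)
    (isHomogeneous_X_mul_X_pow j 0 (a + d)) (by omega) ?_
  simp only [param, map_mul, map_pow, aeval_X, ← pow_mul, ← pow_add]
  congr 1
  rw [hm i, hm j, hm 3, hm₀, hij]
  simp
  ring

lemma tangentConeIdeal_eq_span_phi1_1 (hd : 1 ≤ d) (hm₀ : m 0 = 3 * a + 1)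
    (hm : ∀ i : Fin 4, m i = m 0 + (i : ℕ) * d) (hgcd : Finset.univ.gcd m = 1) :
    tangentConeIdeal k m = Ideal.span (Set.range (phi1_1 a (X 0) (X 1) (X 2) (X 3))) := by
  refine le_antisymm (tangentConeIdeal_le (a := a) (b := 1) (by simp) hd hm₀ hm hgcd
    (Ideal.subset_span ⟨0, rfl⟩) (Ideal.subset_span ⟨1, rfl⟩) (Ideal.subset_span ⟨2, rfl⟩)
    (fun _ => Ideal.subset_span ⟨3, rfl⟩) (fun _ => Ideal.subset_span ⟨4, rfl⟩)
    (Ideal.subset_span ⟨5, rfl⟩)) (Ideal.span_le.mpr ?_)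
  obtain ⟨⟨h1, h2⟩, h3⟩ := minors_mem_tangentConeIdeal (k := k) hm
  have h4 : X 1 * X 3 ^ a ∈ tangentConeIdeal k m :=
    mul_pow_mem_tangentConeIdeal hd hm₀ hm (j := 0) rfl
  have h5 : X 2 * X 3 ^ a ∈ tangentConeIdeal k m :=
    mul_pow_mem_tangentConeIdeal hd hm₀ hm (j := 1) rfl
  have h6 : X 3 * X 3 ^ a ∈ tangentConeIdeal k m :=
    mul_pow_mem_tangentConeIdeal hd hm₀ hm (j := 2) rfl
  rw [← pow_succ'] at h6
  rintro _ ⟨i, rfl⟩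
  fin_cases i
  exacts [h1, h2, h3, h4, h5, h6]

lemma tangentConeIdeal_eq_span_phi1_2 (hd : 1 ≤ d) (hm₀ : m 0 = 3 * a + 2)
    (hm : ∀ i : Fin 4, m i = m 0 + (i : ℕ) * d) (hgcd : Finset.univ.gcd m = 1) :
    tangentConeIdeal k m = Ideal.span (Set.range (phi1_2 a (X 0) (X 1) (X 2) (X 3))) := by
  refine le_antisymm (tangentConeIdeal_le (a := a) (b := 2) (by simp) hd hm₀ hm hgcd
    (Ideal.subset_span ⟨0, rfl⟩) (Ideal.subset_span ⟨1, rfl⟩) (Ideal.subset_span ⟨2, rfl⟩)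
    (by norm_num) (fun _ => Ideal.subset_span ⟨3, rfl⟩)
    (Ideal.subset_span ⟨4, rfl⟩)) (Ideal.span_le.mpr ?_)
  obtain ⟨⟨h1, h2⟩, h3⟩ := minors_mem_tangentConeIdeal (k := k) hm
  have h4 : X 2 * X 3 ^ a ∈ tangentConeIdeal k m :=
    mul_pow_mem_tangentConeIdeal hd hm₀ hm (j := 0) rfl
  have h5 : X 3 * X 3 ^ a ∈ tangentConeIdeal k m :=
    mul_pow_mem_tangentConeIdeal hd hm₀ hm (j := 1) rfl
  rw [← pow_succ'] at h5
  rintro _ ⟨i, rfl⟩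
  fin_cases i
  exacts [h1, h2, h3, h4, h5]

lemma tangentConeIdeal_eq_span_phi1_3 (hd : 1 ≤ d) (hm₀ : m 0 = 3 * a + 3)
    (hm : ∀ i : Fin 4, m i = m 0 + (i : ℕ) * d) (hgcd : Finset.univ.gcd m = 1) :
    tangentConeIdeal k m = Ideal.span (Set.range (phi1_3 a (X 0) (X 1) (X 2) (X 3))) := by
  refine le_antisymm (tangentConeIdeal_le (a := a) (b := 3) (by simp) hd hm₀ hm hgcd
    (Ideal.subset_span ⟨0, rfl⟩) (Ideal.subset_span ⟨1, rfl⟩) (Ideal.subset_span ⟨2, rfl⟩)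
    (by norm_num) (by norm_num) (Ideal.subset_span ⟨3, rfl⟩)) (Ideal.span_le.mpr ?_)
  obtain ⟨⟨h1, h2⟩, h3⟩ := minors_mem_tangentConeIdeal (k := k) hm
  have h4 : X 3 * X 3 ^ a ∈ tangentConeIdeal k m :=
    mul_pow_mem_tangentConeIdeal hd hm₀ hm (j := 0) rfl
  rw [← pow_succ'] at h4
  rintro _ ⟨i, rfl⟩
  fin_cases i
  exacts [h1, h2, h3, h4]

lemma isMinimalFreeResolution_phi_1 (ha : 1 ≤ a) (hd : 1 ≤ d) (hm₀ : m 0 = 3 * a + 1)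
    (hm : ∀ i : Fin 4, m i = m 0 + (i : ℕ) * d) (hgcd : Finset.univ.gcd m = 1) :
    IsMinimalFreeResolution (tangentConeIdeal k m) (phi1_1 a (X 0) (X 1) (X 2) (X 3))
      (phi2_1 a (X 0) (X 1) (X 2) (X 3)) (phi3_1 a (X 0) (X 1) (X 2) (X 3)) where
  surjective := Ideal.Quotient.mk_surjective
  exact_zero := exact_linearCombination_mk (tangentConeIdeal_eq_span_phi1_1 hd hm₀ hm hgcd)
  exact_one := isIndependentQuadruple_X.exact_phi2_1_phi1_1
  exact_two := isIndependentQuadruple_X.exact_phi3_1_phi2_1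
  injective := isIndependentQuadruple_X.injective_phi3_1
  minimal_one := linearCombination_mem_irrelevantIdeal_smul_top fun i => by
    fin_cases i <;> simp [phi1_1]
  minimal_two := mulVec_mem_irrelevantIdeal_smul_top fun i j => by
    -- The entries `y ^ a` are nonunits because `a ≥ 1`.
    fin_cases i <;> fin_cases j <;> simp [phi2_1] <;> omega
  minimal_three := mulVec_mem_irrelevantIdeal_smul_top fun i j => by
    fin_cases i <;> fin_cases j <;> simp [phi3_1] <;> omega
  graded := by
    refine ⟨![2, 2, 2, a + 1, a + 1, a + 1],
      ![3, a + 2, 3, a + 2, a + 2, a + 2, a + 2, a + 2], fun _ => a + 3,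
      fun i => ?_, fun i j => ?_, fun i j => ?_⟩
    · fin_cases i
      exacts [isHomogeneous_sq_sub_mul 1 0 2, isHomogeneous_mul_sub_mul 1 2 0 3,
        isHomogeneous_sq_sub_mul 2 1 3,
        isHomogeneous_X_mul_X_pow 1 3 a, isHomogeneous_X_mul_X_pow 2 3 a,
        isHomogeneous_X_pow 3 (a + 1)]
    · fin_cases i <;> fin_cases j <;> simp [phi2_1]
      all_goals first
          | with_reducible exact ⟨_, isHomogeneous_X k _, by omega⟩
          | with_reducible exact ⟨_, (isHomogeneous_X k _).neg, by omega⟩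
          | with_reducible exact ⟨_, isHomogeneous_X_pow _ _, by omega⟩
    · fin_cases i <;> fin_cases j <;> simp [phi3_1]
      all_goals first
          | with_reducible exact ⟨_, isHomogeneous_X k _, by omega⟩
          | with_reducible exact ⟨_, (isHomogeneous_X k _).neg, by omega⟩
          | with_reducible exact ⟨_, isHomogeneous_X_pow _ _, by omega⟩

lemma isMinimalFreeResolution_phi_2 (ha : 1 ≤ a) (hd : 1 ≤ d) (hm₀ : m 0 = 3 * a + 2)
    (hm : ∀ i : Fin 4, m i = m 0 + (i : ℕ) * d) (hgcd : Finset.univ.gcd m = 1) :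
    IsMinimalFreeResolution (tangentConeIdeal k m) (phi1_2 a (X 0) (X 1) (X 2) (X 3))
      (phi2_2 a (X 0) (X 1) (X 2) (X 3)) (phi3_2 a (X 0) (X 1) (X 2) (X 3)) where
  surjective := Ideal.Quotient.mk_surjective
  exact_zero := exact_linearCombination_mk (tangentConeIdeal_eq_span_phi1_2 hd hm₀ hm hgcd)
  exact_one := isIndependentQuadruple_X.exact_phi2_2_phi1_2
  exact_two := isIndependentQuadruple_X.exact_phi3_2_phi2_2
  injective := isIndependentQuadruple_X.injective_phi3_2
  minimal_one := linearCombination_mem_irrelevantIdeal_smul_top fun i => by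
    fin_cases i <;> simp [phi1_2]
  minimal_two := mulVec_mem_irrelevantIdeal_smul_top fun i j => by
    fin_cases i <;> fin_cases j <;> simp [phi2_2] <;> omega
  minimal_three := mulVec_mem_irrelevantIdeal_smul_top fun i j => by
    fin_cases i <;> fin_cases j <;> simp [phi3_2]
  graded := by
    refine ⟨![2, 2, 2, a + 1, a + 1], ![3, 3, a + 2, a + 2, a + 2], fun _ => a + 4, fun i => ?_,
      fun i j => ?_, fun i j => ?_⟩
    · fin_cases i
      exacts [isHomogeneous_sq_sub_mul 1 0 2, isHomogeneous_mul_sub_mul 1 2 0 3,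
        isHomogeneous_sq_sub_mul 2 1 3,
        isHomogeneous_X_mul_X_pow 2 3 a, isHomogeneous_X_pow 3 (a + 1)]
    · fin_cases i <;> fin_cases j <;> simp [phi2_2]
      all_goals first
          | with_reducible exact ⟨_, isHomogeneous_X k _, by omega⟩
          | with_reducible exact ⟨_, (isHomogeneous_X k _).neg, by omega⟩
          | with_reducible exact ⟨_, isHomogeneous_X_pow _ _, by omega⟩
    · fin_cases i <;> fin_cases j <;> simp [phi3_2]
      exacts [⟨_, isHomogeneous_X_pow _ _, by omega⟩,
        ⟨_, isHomogeneous_X_mul_X_pow _ _ _, by omega⟩,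
        fun _ => ⟨_, isHomogeneous_neg_sq_add_mul 2 1 3, by omega⟩,
        fun _ => ⟨_, isHomogeneous_mul_sub_mul 1 2 0 3, by omega⟩,
        fun _ => ⟨_, isHomogeneous_sq_sub_mul 1 0 2, by omega⟩]

lemma isMinimalFreeResolution_phi_3 (hd : 1 ≤ d) (hm₀ : m 0 = 3 * a + 3)
    (hm : ∀ i : Fin 4, m i = m 0 + (i : ℕ) * d) (hgcd : Finset.univ.gcd m = 1) :
    IsMinimalFreeResolution (tangentConeIdeal k m) (phi1_3 a (X 0) (X 1) (X 2) (X 3))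
      (phi2_3 a (X 0) (X 1) (X 2) (X 3)) (phi3_3 a (X 0) (X 1) (X 2) (X 3)) where
  surjective := Ideal.Quotient.mk_surjective
  exact_zero := exact_linearCombination_mk (tangentConeIdeal_eq_span_phi1_3 hd hm₀ hm hgcd)
  exact_one := isIndependentQuadruple_X.exact_phi2_3_phi1_3
  exact_two := isIndependentQuadruple_X.exact_phi3_3_phi2_3
  injective := isIndependentQuadruple_X.injective_phi3_3
  minimal_one := linearCombination_mem_irrelevantIdeal_smul_top fun i => by
    fin_cases i <;> simp [phi1_3]
  minimal_two := mulVec_mem_irrelevantIdeal_smul_top fun i j => by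
    fin_cases i <;> fin_cases j <;> simp [phi2_3]
  minimal_three := mulVec_mem_irrelevantIdeal_smul_top fun i j => by
    fin_cases i <;> fin_cases j <;> simp [phi3_3]
  graded := by
    refine ⟨![2, 2, 2, a + 1], ![3, a + 3, 3, a + 3, a + 3], fun _ => a + 4, fun i => ?_,
      fun i j => ?_, fun i j => ?_⟩
    · fin_cases i
      exacts [isHomogeneous_sq_sub_mul 1 0 2, isHomogeneous_mul_sub_mul 1 2 0 3,
        isHomogeneous_sq_sub_mul 2 1 3, isHomogeneous_X_pow 3 (a + 1)]
    · fin_cases i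
      -- The last row is separated because its nonzero entries are the negated minors.
      pick_goal 4
      · fin_cases j <;> simp [phi2_3]
        exacts [fun _ => ⟨_, isHomogeneous_neg_sq_add_mul 1 0 2, by omega⟩,
          fun _ => ⟨_, isHomogeneous_neg_mul_add_mul 1 2 0 3, by omega⟩,
          fun _ => ⟨_, isHomogeneous_neg_sq_add_mul 2 1 3, by omega⟩]
      all_goals fin_cases j <;> simp [phi2_3]
      all_goals first
          | with_reducible exact ⟨_, isHomogeneous_X k _, by omega⟩
          | with_reducible exact ⟨_, (isHomogeneous_X k _).neg, by omega⟩
          | with_reducible exact ⟨_, isHomogeneous_X_pow _ _, by omega⟩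
    · fin_cases i <;> fin_cases j <;> simp [phi3_3]
      all_goals first
          | with_reducible exact ⟨_, isHomogeneous_X k _, by omega⟩
          | with_reducible exact ⟨_, (isHomogeneous_X k _).neg, by omega⟩
          | with_reducible exact ⟨_, isHomogeneous_X_pow _ _, by omega⟩

end Resolution

end MonomialCurve

theorem theorem3p1 {k : Type*} [Field k] (a b d : ℕ) (m : Fin 4 → ℕ)
    (ha : 1 ≤ a) (hb : b ∈ Set.Icc 1 3) (hd : 1 ≤ d)
    (hm₀ : m 0 = 3 * a + b) (hm : ∀ i : Fin 4, m i = m 0 + (i : ℕ) * d)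
    (hgcd : Finset.univ.gcd m = 1) :
    (b = 1 → MonomialCurve.IsMinimalFreeResolution (MonomialCurve.tangentConeIdeal k m)
      (MonomialCurve.phi1_1 a (X 0) (X 1) (X 2) (X 3))
      (MonomialCurve.phi2_1 a (X 0) (X 1) (X 2) (X 3))
      (MonomialCurve.phi3_1 a (X 0) (X 1) (X 2) (X 3))) ∧
    (b = 2 → MonomialCurve.IsMinimalFreeResolution (MonomialCurve.tangentConeIdeal k m)
      (MonomialCurve.phi1_2 a (X 0) (X 1) (X 2) (X 3))
      (MonomialCurve.phi2_2 a (X 0) (X 1) (X 2) (X 3))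
      (MonomialCurve.phi3_2 a (X 0) (X 1) (X 2) (X 3))) ∧
    (b = 3 → MonomialCurve.IsMinimalFreeResolution (MonomialCurve.tangentConeIdeal k m)
      (MonomialCurve.phi1_3 a (X 0) (X 1) (X 2) (X 3))
      (MonomialCurve.phi2_3 a (X 0) (X 1) (X 2) (X 3))
      (MonomialCurve.phi3_3 a (X 0) (X 1) (X 2) (X 3))) := by
  refine ⟨?_, ?_, ?_⟩
  · rintro rfl
    exact MonomialCurve.isMinimalFreeResolution_phi_1 ha hd hm₀ hm hgcd
  · rintro rfl
    exact MonomialCurve.isMinimalFreeResolution_phi_2 ha hd hm₀ hm hgcd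
  · rintro rfl
    exact MonomialCurve.isMinimalFreeResolution_phi_3 hd hm₀ hm hgcd
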